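/- For integers $d\ge 2$ and $t\ge 0$, a spherical $t$-design in the unit sphere $S^{d-1}\subset\mathbb{R}^d$ is a nonempty finite set $X\subset S^{d-1}$ such that $$\frac{1}{|X|}\sum_{x\in X} f(x)=\frac{1}{|S^{d-1}|}\int_{S^{d-1}} f(x)\,dx$$ for every real polynomial $f$ in $d$ variables of degree at most $t$, where $dx$ is the surface measure and $|S^{d-1}|$ is the total surface measure of the sphere. For an integer $m\ge 1$, an $m$-stiff configuration in $S^{d-1}$ is a spherical $(2m-1)$-design $X\subset S^{d-1}$ for which there is a point $z\in S^{d-1}$ such that the set $\{\langle z,x\rangle : x\in X\}$ has at most $m$ elements. Theorem. 1. For every even integer $d\ge 8$ there is an $N$ such that for all $n\ge N$ there is no $2n$-stiff configuration in $S^{d-1}$. 2. For every even integer $d\ge 12$ there is an $N$ such that for all $n\ge N$ there is no $(2n+1)$-stiff configuration in $S^{d-1}$. 3. For every odd integer $d\ge 3$ there is an $M$ such that for all $m\ge M$ there is no $m$-stiff configuration in $S^{d-1}$. -/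

import Mathlib

open MeasureTheory

/-- The unit sphere `S^{d-1}` in the Euclidean space `ℝ^d`. -/
abbrev UnitSphere (d : ℕ) : Type :=
  Metric.sphere (0 : EuclideanSpace ℝ (Fin d)) 1

/-- The surface measure on `S^{d-1}` induced by Lebesgue measure on `ℝ^d`. -/
noncomputable def surfaceMeasure (d : ℕ) : Measure (UnitSphere d) :=
  (volume : Measure (EuclideanSpace ℝ (Fin d))).toSphere

/-- The value of a real polynomial in `d` variables at a point of `S^{d-1}`. -/
noncomputable def evalSphere {d : ℕ} (f : MvPolynomial (Fin d) ℝ) (x : UnitSphere d) : ℝ :=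
  MvPolynomial.eval (fun i => (x : EuclideanSpace ℝ (Fin d)) i) f

/-- A spherical `t`-design: a nonempty finite subset `X` of `S^{d-1}` such that, for every real
polynomial of degree at most `t`, its mean over `X` is its mean over the sphere. -/
def IsSphericalDesign {d : ℕ} (t : ℕ) (X : Finset (UnitSphere d)) : Prop :=
  X.Nonempty ∧
    ∀ f : MvPolynomial (Fin d) ℝ, f.totalDegree ≤ t →
      (1 / (X.card : ℝ)) * ∑ x ∈ X, evalSphere f x =
        (1 / (surfaceMeasure d).real Set.univ) * ∫ x, evalSphere f x ∂(surfaceMeasure d)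

/-- The set `D(z, X) = {⟨z, x⟩ : x ∈ X}` of inner products. -/
def innerProducts {d : ℕ} (z : UnitSphere d) (X : Finset (UnitSphere d)) : Set ℝ :=
  {s : ℝ | ∃ x ∈ X,
    s = inner ℝ (z : EuclideanSpace ℝ (Fin d)) (x : EuclideanSpace ℝ (Fin d))}

/-- `X` is an `m`-stiff configuration in `S^{d-1}`, for a positive integer `m`: it is a spherical
`(2m-1)`-design and `|D(z, X)| ≤ m` for some `z ∈ S^{d-1}`. (The set `D(z, X)` is finite, so
`Set.ncard` is its cardinality.) -/
def IsStiff {d : ℕ} (m : ℕ) (X : Finset (UnitSphere d)) : Prop :=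
  1 ≤ m ∧ IsSphericalDesign (2 * m - 1) X ∧
    {z : UnitSphere d | (innerProducts z X).ncard ≤ m}.Nonempty

/-!
For every `d ≥ 3`, not only for the dimensions in the statement, `m`-stiff configurations in
`S^{d-1}` exist for finitely many `m` only (`IsStiff.le`). The reason is that the squares of the
inner products of a stiff configuration are forced to be rational, and that they are roots of an
integer polynomial with too small a leading coefficient.

Let `X` be `m`-stiff with respect to `z`, let `D` be the set of inner products `⟨z, x⟩` and let
`n α` be the number of `x ∈ X` with `⟨z, x⟩ = α`. The vector field `p(⟨z, x⟩) (z - ⟨z, x⟩ x)` has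
mean divergence zero over the sphere (`integral_zonalDivergence`), so that by the design property
`∑ α ∈ D, n α ((1 - α²) p'(α) - (d - 1) α p(α)) = 0` for all polynomials `p` of degree at most
`2m - 2`. This relation is all that is used about `X`. Let `G = ∏ α ∈ D, (X - α)` and test it on
products of two factors close to `G`:

* `G G'` shows that `D` has `m` elements (`IsZonalQuadrature.le_two_mul_card`);
* `(G / (X - α))²` gives the Gegenbauer differential equation for `G`
  (`IsZonalQuadrature.isGegenbauer_nodal`), whose coefficient recursion makes `G` rational;
* `G² / ((X - α) (X - β))` shows that `n α (1 - α²) G'(α)²` is independent of `α`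
  (`IsZonalQuadrature.weight_mul_eq`).

As the moments `∑ n α α^k` are rational, so is this common value; since `n α` is an integer,
`(1 - α²) G'(α)²` is rational, hence takes the same value at every conjugate of `α`. On the roots of
`G` it agrees with Sonine's function `(1 - X²) G'² + m (m + d - 2) G²`, which is even and strictly
increasing on `[0, ∞)` as its derivative is `2 (d - 2) X G'²`. So the conjugates of `α` are among
`±α`, and `α²` is rational (`IsZonalQuadrature.exists_rat_sq`).

Finally, clearing denominators in `G` with binomial-type numbers, the at least `m / 2` distinct
rationals `α² ∈ [0, 1]` are roots of an integer polynomial with nonzero leading coefficient at most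
`(2d)^m` (`Polynomial.IsGegenbauer.exists_int_polynomial_sq`). By Gauss's lemma the product of their
denominators is at most `(2d)^m` (`prod_den_dvd_leadingCoeff`). But boundedly many of these
denominators are at most `(2d)^3`, which bounds `m` (`card_le_of_prod_den_le`).
-/

/-! ### Zonal moments of the sphere -/

section Sphere

variable {E : Type*} [NormedAddCommGroup E] [InnerProductSpace ℝ E] [FiniteDimensional ℝ E]
  [MeasurableSpace E] [BorelSpace E]

theorem integrable_inner_pow_mul_gaussian [Nontrivial E] (z : E) (hz : ‖z‖ = 1) (k : ℕ) :
    Integrable (fun y : E => inner ℝ z y ^ k * Real.exp (-‖y‖ ^ 2)) := by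
  have h : Integrable (fun y : E => ‖y‖ ^ k * Real.exp (-‖y‖ ^ 2)) := by
    rw [integrable_fun_norm_addHaar volume (f := fun r : ℝ => r ^ k * Real.exp (-r ^ 2))]
    have := integrableOn_rpow_mul_exp_neg_mul_sq (b := 1) one_pos
      (s := ((Module.finrank ℝ E - 1 + k : ℕ) : ℝ))
      (by have : (0 : ℝ) ≤ ((Module.finrank ℝ E - 1 + k : ℕ) : ℝ) := Nat.cast_nonneg _
          linarith)
    refine this.congr_fun (fun r hr => ?_) measurableSet_Ioi
    simp only [Real.rpow_natCast, smul_eq_mul, pow_add, mul_assoc, neg_mul, one_mul]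
  refine h.mono' (by fun_prop) (Filter.Eventually.of_forall fun y => ?_)
  rw [norm_mul, norm_pow, Real.norm_eq_abs, Real.norm_eq_abs, Real.abs_exp]
  gcongr
  simpa [hz] using abs_real_inner_le_norm z y

/-- Integration by parts in the direction `z` against the Gaussian weight. -/
theorem gaussian_moment_succ [Nontrivial E] (z : E) (hz : ‖z‖ = 1) (k : ℕ) :
    2 * ∫ y : E, inner ℝ z y ^ (k + 1) * Real.exp (-‖y‖ ^ 2) =
      k * ∫ y : E, inner ℝ z y ^ (k - 1) * Real.exp (-‖y‖ ^ 2) := by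
  have key := integral_bilinear_hasLineDerivAt_right_eq_neg_left_of_integrable
    (μ := (volume : Measure E)) (v := z) (B := ContinuousLinearMap.mul ℝ ℝ)
    (f := fun y : E => inner ℝ z y ^ k) (f' := fun y : E => k * inner ℝ z y ^ (k - 1))
    (g := fun y : E => Real.exp (-‖y‖ ^ 2))
    (g' := fun y : E => -2 * inner ℝ z y * Real.exp (-‖y‖ ^ 2))
    (by
      simp only [ContinuousLinearMap.mul_apply', mul_assoc]
      exact (integrable_inner_pow_mul_gaussian z hz (k - 1)).const_mul _)
    (by
      refine ((integrable_inner_pow_mul_gaussian z hz (k + 1)).const_mul (-2)).congr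
        (Filter.Eventually.of_forall fun y => ?_)
      simp only [ContinuousLinearMap.mul_apply']
      ring)
    (by simpa only [ContinuousLinearMap.mul_apply'] using
      integrable_inner_pow_mul_gaussian z hz k)
    (fun y _ => by
      have h1 : HasDerivAt (fun t : ℝ => inner ℝ z (y + t • z)) 1 0 := by
        have : (fun t : ℝ => inner ℝ z (y + t • z)) = fun t : ℝ => inner ℝ z y + t := by
          funext t
          simp [inner_add_right, inner_smul_right, hz]
        rw [this]
        exact (hasDerivAt_id (0 : ℝ)).const_add _
      have h2 := h1.pow k
      simp only [zero_smul, add_zero, mul_one] at h2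
      exact h2)
    (fun y _ => by
      have h1 : HasDerivAt (fun t : ℝ => -‖y + t • z‖ ^ 2) (-2 * inner ℝ z y) 0 := by
        have : (fun t : ℝ => -‖y + t • z‖ ^ 2) =
            fun t : ℝ => -(‖y‖ ^ 2 + t * (2 * inner ℝ z y) + t ^ 2) := by
          funext t
          rw [norm_add_sq_real, norm_smul, hz, inner_smul_right, real_inner_comm]
          simp
          ring
        rw [this]
        have h := ((((hasDerivAt_id (0 : ℝ)).mul_const (2 * inner ℝ z y)).const_add
          (‖y‖ ^ 2)).add ((hasDerivAt_id (0 : ℝ)).pow 2)).neg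
        simp only [id, one_mul, Nat.cast_ofNat, Nat.add_one_sub_one, pow_one, mul_zero,
          add_zero, mul_one] at h
        rw [neg_mul]
        exact h
      have h2 := h1.exp
      simpa [HasLineDerivAt, mul_comm] using h2)
  simp only [ContinuousLinearMap.mul_apply'] at key
  have h1 : ∀ y : E, inner ℝ z y ^ k * (-2 * inner ℝ z y * Real.exp (-‖y‖ ^ 2)) =
      -2 * (inner ℝ z y ^ (k + 1) * Real.exp (-‖y‖ ^ 2)) := fun y => by ring
  simp only [h1] at key
  simp only [mul_assoc, integral_const_mul] at key
  linarith

/-- Polar coordinates split a Gaussian moment into a moment of the sphere and a radial factor. -/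
theorem gaussian_moment_eq_sphere_moment [Nontrivial E] (z : E) (k : ℕ) :
    ∫ y : E, inner ℝ z y ^ k * Real.exp (-‖y‖ ^ 2) =
      (∫ x : Metric.sphere (0 : E) 1, inner ℝ z (x : E) ^ k ∂(volume : Measure E).toSphere) *
        (1 / 2 * Real.Gamma (((k : ℝ) + Module.finrank ℝ E) / 2)) := by
  have hpos : 0 < Module.finrank ℝ E := Module.finrank_pos
  have hR : ∫ r : Set.Ioi (0 : ℝ), (r : ℝ) ^ k * Real.exp (-(r : ℝ) ^ 2)
        ∂(Measure.volumeIoiPow (Module.finrank ℝ E - 1)) =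
      1 / 2 * Real.Gamma (((k : ℝ) + Module.finrank ℝ E) / 2) := by
    simp only [Measure.volumeIoiPow, ENNReal.ofReal]
    rw [integral_withDensity_eq_integral_smul
      ((measurable_subtype_coe.pow_const _).real_toNNReal),
      integral_subtype_comap measurableSet_Ioi fun a : ℝ =>
        Real.toNNReal (a ^ (Module.finrank ℝ E - 1)) • (a ^ k * Real.exp (-a ^ 2))]
    have h := integral_rpow_mul_exp_neg_rpow (p := 2) two_pos
      (q := ((Module.finrank ℝ E - 1 + k : ℕ) : ℝ))
      (by have : (0 : ℝ) ≤ ((Module.finrank ℝ E - 1 + k : ℕ) : ℝ) := Nat.cast_nonneg _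
          linarith)
    have e : ((Module.finrank ℝ E - 1 + k : ℕ) : ℝ) + 1 = (k : ℝ) + Module.finrank ℝ E := by
      push_cast [Nat.cast_sub (show 1 ≤ Module.finrank ℝ E from hpos)]
      ring
    rw [e] at h
    rw [← h]
    refine setIntegral_congr_fun measurableSet_Ioi fun r hr => ?_
    have hr' : (0 : ℝ) < r := hr
    simp only [NNReal.smul_def, smul_eq_mul, Real.rpow_natCast, Real.rpow_ofNat]
    rw [Real.coe_toNNReal _ (by positivity), pow_add]
    ring
  calc ∫ y : E, inner ℝ z y ^ k * Real.exp (-‖y‖ ^ 2)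
      = ∫ y : ({(0)}ᶜ : Set E), inner ℝ z (y : E) ^ k * Real.exp (-‖(y : E)‖ ^ 2)
          ∂((volume : Measure E).comap (↑)) := by
        rw [integral_subtype_comap (measurableSet_singleton _).compl
          fun y : E => inner ℝ z y ^ k * Real.exp (-‖y‖ ^ 2), restrict_compl_singleton]
    _ = ∫ q : Metric.sphere (0 : E) 1 × Set.Ioi (0 : ℝ),
          inner ℝ z (q.1 : E) ^ k * ((q.2 : ℝ) ^ k * Real.exp (-(q.2 : ℝ) ^ 2))
          ∂((volume : Measure E).toSphere.prod
            (Measure.volumeIoiPow (Module.finrank ℝ E - 1))) := by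
        rw [← (volume : Measure E).measurePreserving_homeomorphUnitSphereProd.integral_comp
          (Homeomorph.measurableEmbedding _)]
        refine integral_congr_ae (Filter.Eventually.of_forall fun y => ?_)
        have hy : ‖(y : E)‖ ≠ 0 := norm_ne_zero_iff.2 y.2
        simp only [homeomorphUnitSphereProd_apply_fst_coe, homeomorphUnitSphereProd_apply_snd_coe,
          inner_smul_right]
        rw [mul_pow, inv_pow]
        field_simp
    _ = _ := by
        rw [integral_prod_mul (fun x : Metric.sphere (0 : E) 1 => inner ℝ z (x : E) ^ k)
          (fun r : Set.Ioi (0 : ℝ) => (r : ℝ) ^ k * Real.exp (-(r : ℝ) ^ 2)), hR]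

theorem sphere_moment_succ [Nontrivial E] (z : E) (hz : ‖z‖ = 1) (k : ℕ) :
    ((k : ℝ) + Module.finrank ℝ E - 1) *
        ∫ x : Metric.sphere (0 : E) 1, inner ℝ z (x : E) ^ (k + 1)
          ∂(volume : Measure E).toSphere =
      k * ∫ x : Metric.sphere (0 : E) 1, inner ℝ z (x : E) ^ (k - 1)
          ∂(volume : Measure E).toSphere := by
  have hpos : (1 : ℝ) ≤ Module.finrank ℝ E := by
    exact_mod_cast Module.finrank_pos (R := ℝ) (M := E)
  have h := gaussian_moment_succ z hz k
  rw [gaussian_moment_eq_sphere_moment, gaussian_moment_eq_sphere_moment] at h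
  rcases Nat.eq_zero_or_pos k with rfl | hk
  · have hG : 0 < Real.Gamma ((((0 + 1 : ℕ) : ℝ) + Module.finrank ℝ E) / 2) :=
      Real.Gamma_pos_of_pos (by positivity)
    simp only [Nat.cast_zero, zero_mul] at h ⊢
    have h0 := (mul_eq_zero.1 ((mul_eq_zero.1 h).resolve_left two_ne_zero)).resolve_right
      (by positivity)
    rw [h0, mul_zero]
  · have hk1 : (1 : ℝ) ≤ k := by exact_mod_cast hk
    set s : ℝ := ((k : ℝ) + Module.finrank ℝ E - 1) / 2 with hs
    have hs0 : 0 < s := by rw [hs]; linarith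
    have e1 : (((k + 1 : ℕ) : ℝ) + Module.finrank ℝ E) / 2 = s + 1 := by
      rw [hs]; push_cast; ring
    have e2 : (((k - 1 : ℕ) : ℝ) + Module.finrank ℝ E) / 2 = s := by
      rw [hs, Nat.cast_sub (by omega : 1 ≤ k)]; push_cast; ring
    have e3 : ((k : ℝ) + Module.finrank ℝ E - 1) = 2 * s := by rw [hs]; ring
    rw [e1, e2, Real.Gamma_add_one hs0.ne'] at h
    have hG : Real.Gamma s ≠ 0 := (Real.Gamma_pos_of_pos hs0).ne'
    rw [e3]
    apply mul_right_cancel₀ hG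
    linear_combination 2 * h

open Polynomial in
/-- The polynomial `(1 - X²) p' - c X p`. For `c = d - 1` its value at `⟨z, x⟩` is the divergence
on `S^{d-1}` of the tangential vector field `p(⟨z, x⟩) (z - ⟨z, x⟩ x)`. -/
noncomputable def zonalDivergence (c : ℝ) (p : ℝ[X]) : ℝ[X] :=
  (1 - X ^ 2) * derivative p - C c * X * p

theorem eval_zonalDivergence (c : ℝ) (p : Polynomial ℝ) (x : ℝ) :
    (zonalDivergence c p).eval x =
      (1 - x ^ 2) * (Polynomial.derivative p).eval x - c * x * p.eval x := by
  simp [zonalDivergence]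

/-- The divergence theorem on the sphere for zonal vector fields. -/
theorem integral_zonalDivergence [Nontrivial E] (z : E) (hz : ‖z‖ = 1) (p : Polynomial ℝ) :
    ∫ x : Metric.sphere (0 : E) 1,
      (zonalDivergence (Module.finrank ℝ E - 1) p).eval (inner ℝ z (x : E))
        ∂(volume : Measure E).toSphere = 0 := by
  have hint : ∀ q : Polynomial ℝ, Integrable
      (fun x : Metric.sphere (0 : E) 1 => q.eval (inner ℝ z (x : E)))
      (volume : Measure E).toSphere := fun q =>
    Continuous.integrable_of_hasCompactSupport (by fun_prop) (HasCompactSupport.of_compactSpace _)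
  induction p using Polynomial.induction_on' with
  | add p q hp hq =>
    have e : zonalDivergence ((Module.finrank ℝ E : ℝ) - 1) (p + q) =
        zonalDivergence ((Module.finrank ℝ E : ℝ) - 1) p +
        zonalDivergence ((Module.finrank ℝ E : ℝ) - 1) q := by
      simp only [zonalDivergence, Polynomial.derivative_add]; ring
    simp only [e, Polynomial.eval_add]
    rw [integral_add (hint _) (hint _), hp, hq, add_zero]
  | monomial k a =>
    have e : ∀ s : ℝ, (zonalDivergence ((Module.finrank ℝ E : ℝ) - 1)
        (Polynomial.monomial k a)).eval s =
        a * k * s ^ (k - 1) - a * ((k : ℝ) + Module.finrank ℝ E - 1) * s ^ (k + 1) := by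
      intro s
      simp only [zonalDivergence, Polynomial.derivative_monomial, Polynomial.eval_sub,
        Polynomial.eval_mul, Polynomial.eval_monomial, Polynomial.eval_one, Polynomial.eval_pow,
        Polynomial.eval_X, Polynomial.eval_C]
      rcases k with _ | k
      · simp; ring
      · simp only [Nat.add_sub_cancel]; push_cast; ring
    have hp : ∀ j : ℕ, Integrable
        (fun x : Metric.sphere (0 : E) 1 => inner ℝ z (x : E) ^ j)
        (volume : Measure E).toSphere := fun j => by simpa using hint (Polynomial.X ^ j)
    simp only [e]
    rw [integral_sub ((hp _).const_mul _) ((hp _).const_mul _), integral_const_mul,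
      integral_const_mul]
    linear_combination -a * sphere_moment_succ z hz k

end Sphere

/-- Averaging over a spherical design annihilates `zonalDivergence`, as averaging over the sphere
does. -/
theorem IsSphericalDesign.sum_zonalDivergence {d t : ℕ} (hd : 1 ≤ d) {X : Finset (UnitSphere d)}
    (hX : IsSphericalDesign t X) (z : UnitSphere d) (p : Polynomial ℝ)
    (hp : p.natDegree + 1 ≤ t) :
    ∑ x ∈ X, (zonalDivergence (d - 1) p).eval
      (inner ℝ (z : EuclideanSpace ℝ (Fin d)) (x : EuclideanSpace ℝ (Fin d))) = 0 := by
  have : Nonempty (Fin d) := ⟨⟨0, hd⟩⟩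
  have hz : ‖(z : EuclideanSpace ℝ (Fin d))‖ = 1 := by simp
  have hint := integral_zonalDivergence (z : EuclideanSpace ℝ (Fin d)) hz p
  rw [finrank_euclideanSpace_fin] at hint
  set q := zonalDivergence (d - 1) p with hq
  have hqd : q.natDegree ≤ t := by
    rw [hq, zonalDivergence]
    refine (Polynomial.natDegree_sub_le _ _).trans (max_le ?_ ?_)
    · rcases Nat.eq_zero_or_pos p.natDegree with h0 | h0
      · rw [Polynomial.eq_C_of_natDegree_eq_zero h0]; simp
      · refine Polynomial.natDegree_mul_le.trans ?_
        have h1 : (1 - Polynomial.X ^ 2 : Polynomial ℝ).natDegree ≤ 2 := by compute_degree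
        have h2 := Polynomial.natDegree_derivative_le p
        omega
    · refine Polynomial.natDegree_mul_le.trans ?_
      have h1 : (Polynomial.C ((d : ℝ) - 1) * Polynomial.X : Polynomial ℝ).natDegree ≤ 1 := by
        compute_degree
      omega
  -- the linear form `⟨z, ·⟩` as a polynomial in `d` variables
  set ℓ : MvPolynomial (Fin d) ℝ :=
    ∑ i, MvPolynomial.C ((z : EuclideanSpace ℝ (Fin d)) i) * MvPolynomial.X i with hℓ
  have hℓd : ℓ.totalDegree ≤ 1 := by
    refine (MvPolynomial.totalDegree_finsetSum_le fun i _ => ?_)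
    refine (MvPolynomial.totalDegree_mul _ _).trans ?_
    simp
  set f : MvPolynomial (Fin d) ℝ := Polynomial.aeval ℓ q with hf
  have hfd : f.totalDegree ≤ t := by
    rw [hf, Polynomial.aeval_eq_sum_range]
    refine (MvPolynomial.totalDegree_finsetSum_le fun i hi => ?_)
    refine (MvPolynomial.totalDegree_smul_le _ _).trans ?_
    refine (MvPolynomial.totalDegree_pow _ _).trans ?_
    have := Finset.mem_range.1 hi
    calc i * ℓ.totalDegree ≤ i * 1 := Nat.mul_le_mul_left _ hℓd
      _ ≤ t := by omega
  have hev : ∀ x : UnitSphere d, evalSphere f x = q.eval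
      (inner ℝ (z : EuclideanSpace ℝ (Fin d)) (x : EuclideanSpace ℝ (Fin d))) := by
    intro x
    have h1 : MvPolynomial.eval (fun i => (x : EuclideanSpace ℝ (Fin d)) i) ℓ =
        inner ℝ (z : EuclideanSpace ℝ (Fin d)) (x : EuclideanSpace ℝ (Fin d)) := by
      simp [hℓ, PiLp.inner_apply, mul_comm]
    have h2 : (MvPolynomial.eval fun i => (x : EuclideanSpace ℝ (Fin d)) i).comp
        (algebraMap ℝ (MvPolynomial (Fin d) ℝ)) = RingHom.id ℝ := RingHom.ext fun a => by simp
    rw [evalSphere, hf, Polynomial.aeval_def, Polynomial.hom_eval₂, h1, h2, Polynomial.eval₂_id]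
  have h := hX.2 f hfd
  simp only [hev] at h
  have hc : (0 : ℝ) < X.card := by exact_mod_cast hX.1.card_pos
  change _ = _ * ∫ x, Polynomial.eval _ q ∂(volume : Measure _).toSphere at h
  rw [hint, mul_zero] at h
  exact (mul_eq_zero.1 h).resolve_left (by positivity)

/-! ### Quadrature formulas for zonal functions -/

namespace Lagrange

open Polynomial

variable {D : Finset ℝ}

theorem eval_derivative_nodal_ne_zero {α : ℝ} (hα : α ∈ D) :
    (derivative (nodal D id)).eval α ≠ 0 := by
  have h := eval_nodal_derivative_eval_node_eq (v := id) hα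
  rw [id] at h
  rw [h, eval_nodal, Finset.prod_ne_zero_iff]
  intro β hβ
  exact sub_ne_zero.2 (Finset.ne_of_mem_erase hβ).symm

theorem eval_derivative_derivative_nodal {α : ℝ} (hα : α ∈ D) :
    (derivative (derivative (nodal D id))).eval α =
      2 * (derivative (nodal (D.erase α) id)).eval α := by
  rw [nodal_eq_mul_nodal_erase hα]
  simp
  ring

theorem eval_nodal_erase_of_ne {α β : ℝ} (hβ : β ∈ D) (h : β ≠ α) :
    (nodal (D.erase α) id).eval β = 0 :=
  eval_nodal_at_node (v := id) (Finset.mem_erase.2 ⟨h, hβ⟩)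

theorem eval_nodal_erase_self {α : ℝ} (hα : α ∈ D) :
    (nodal (D.erase α) id).eval α = (derivative (nodal D id)).eval α :=
  (eval_nodal_derivative_eval_node_eq (v := id) hα).symm

end Lagrange

open Polynomial in
/-- Positive integer weights `n γ` at the points `γ` of a finite set `D ⊂ ℝ` whose weighted sum
annihilates `zonalDivergence (d - 1) p` whenever this has degree at most `t`. Since the moments of
the weight `(1 - s²)^((d-3)/2)` on `[-1, 1]` are determined up to scale by this relation, it says
that the weights form a quadrature formula of strength `t` for that weight. -/
structure IsZonalQuadrature (d t : ℕ) (D : Finset ℝ) (n : ℝ → ℕ) : Prop where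
  pos : ∀ γ ∈ D, 0 < n γ
  sum_eq_zero : ∀ p : ℝ[X], p.natDegree + 1 ≤ t →
    ∑ γ ∈ D, n γ * (zonalDivergence (d - 1) p).eval γ = 0

namespace IsZonalQuadrature

open Polynomial Lagrange

variable {d t : ℕ} {D : Finset ℝ} {n : ℝ → ℕ}

/-- The Gegenbauer differential equation holds at the nodes: test the quadrature formula on the
square of `nodal (D.erase α) id`. -/
theorem ode_at_node (hQ : IsZonalQuadrature d t D n) (ht : 2 * D.card ≤ t + 1) {α : ℝ}
    (hα : α ∈ D) :
    (1 - α ^ 2) * (derivative (derivative (nodal D id))).eval α =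
      (d - 1) * α * (derivative (nodal D id)).eval α := by
  have hcard : 1 ≤ D.card := Finset.card_pos.2 ⟨α, hα⟩
  have h := hQ.sum_eq_zero (nodal (D.erase α) id ^ 2) (by
    rw [natDegree_pow, natDegree_nodal, Finset.card_erase_of_mem hα]; omega)
  rw [Finset.sum_eq_single_of_mem α hα] at h
  · have hn : (n α : ℝ) ≠ 0 := by exact_mod_cast (hQ.pos α hα).ne'
    have h := (mul_eq_zero.1 h).resolve_left hn
    rw [eval_zonalDivergence, derivative_pow] at h
    simp only [eval_mul, eval_pow, eval_C, eval_nodal_erase_self hα] at h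
    rw [eval_derivative_derivative_nodal hα]
    apply mul_left_cancel₀ (eval_derivative_nodal_ne_zero hα)
    norm_num at h
    linear_combination h
  · intro β hβ hne
    rw [eval_zonalDivergence, derivative_pow]
    simp [eval_nodal_erase_of_ne hβ hne]

/-- The Christoffel numbers of the quadrature formula: `n α` is inversely proportional to
`(1 - α²) G'(α)²`, where `G` is the nodal polynomial. -/
theorem weight_mul_eq (hQ : IsZonalQuadrature d t D n) (ht : 2 * D.card ≤ t + 1) {α β : ℝ}
    (hα : α ∈ D) (hβ : β ∈ D) :
    n α * ((1 - α ^ 2) * (derivative (nodal D id)).eval α ^ 2) =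
      n β * ((1 - β ^ 2) * (derivative (nodal D id)).eval β ^ 2) := by
  rcases eq_or_ne α β with rfl | hne
  · rfl
  have hcard : 1 ≤ D.card := Finset.card_pos.2 ⟨α, hα⟩
  have h := hQ.sum_eq_zero (nodal (D.erase α) id * nodal (D.erase β) id) (by
    refine (Nat.add_le_add_right natDegree_mul_le 1).trans ?_
    rw [natDegree_nodal, natDegree_nodal, Finset.card_erase_of_mem hα,
      Finset.card_erase_of_mem hβ]
    omega)
  have key : ∀ {a b : ℝ}, a ∈ D → b ∈ D → a ≠ b →
      (derivative (nodal (D.erase b) id)).eval a * (a - b) = (derivative (nodal D id)).eval a := by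
    intro a b ha hb hab
    have h1 := congrArg derivative (nodal_eq_mul_nodal_erase (v := id) hb)
    rw [h1]
    simp [eval_nodal_erase_of_ne ha hab, mul_comm]
  have hαβ := key hα hβ hne
  have hβα := key hβ hα hne.symm
  rw [← Finset.sum_subset (s₁ := {α, β}) (by
      intro x hx; rcases Finset.mem_insert.1 hx with rfl | hx
      · exact hα
      · rwa [Finset.mem_singleton.1 hx]) (by
      intro x hx hx'
      simp only [Finset.mem_insert, Finset.mem_singleton, not_or] at hx'
      rw [eval_zonalDivergence]
      simp [eval_nodal_erase_of_ne hx hx'.1, eval_nodal_erase_of_ne hx hx'.2]),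
    Finset.sum_pair hne] at h
  rw [eval_zonalDivergence, eval_zonalDivergence] at h
  simp only [derivative_mul, eval_add, eval_mul, eval_nodal_erase_self hα,
    eval_nodal_erase_self hβ, eval_nodal_erase_of_ne hα hne, eval_nodal_erase_of_ne hβ hne.symm]
    at h
  rw [← sub_eq_zero]
  rw [← hαβ] at h ⊢
  rw [← hβα] at h ⊢
  linear_combination (α - β) * h

/-- The number of nodes is as large as the strength demands: otherwise `G G'`, with `G` the nodal
polynomial, is an admissible test polynomial, and gives `∑ n γ (1 - γ²) G'(γ)² = 0`. -/
theorem le_two_mul_card (hQ : IsZonalQuadrature d t D n) (hd : 2 ≤ d) (hD : D.Nonempty)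
    (hI : ∀ γ ∈ D, γ ^ 2 ≤ 1) : t ≤ 2 * D.card := by
  by_contra! hlt
  have hcard : 1 ≤ D.card := Finset.card_pos.2 hD
  have h := hQ.sum_eq_zero (nodal D id * derivative (nodal D id)) (by
    refine (Nat.add_le_add_right natDegree_mul_le 1).trans ?_
    have := natDegree_derivative_le (nodal D (id : ℝ → ℝ))
    rw [natDegree_nodal] at *
    omega)
  have hterm : ∀ γ ∈ D, n γ * (zonalDivergence (d - 1)
      (nodal D id * derivative (nodal D id))).eval γ =
        n γ * ((1 - γ ^ 2) * (derivative (nodal D id)).eval γ ^ 2) := by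
    intro γ hγ
    have h0 : (nodal D id).eval γ = 0 := eval_nodal_at_node (v := id) hγ
    rw [eval_zonalDivergence]
    simp only [derivative_mul, eval_add, eval_mul, h0]
    ring
  rw [Finset.sum_congr rfl hterm, Finset.sum_eq_zero_iff_of_nonneg (fun γ hγ =>
    mul_nonneg (Nat.cast_nonneg _) (mul_nonneg (by linarith [hI γ hγ]) (sq_nonneg _)))] at h
  obtain ⟨γ, hγ⟩ := hD
  have hn : (n γ : ℝ) ≠ 0 := by exact_mod_cast (hQ.pos γ hγ).ne'
  have hG := eval_derivative_nodal_ne_zero hγ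
  have h1 := (mul_eq_zero.1 ((mul_eq_zero.1 (h γ hγ)).resolve_left hn)).resolve_right
    (pow_ne_zero 2 hG)
  have h2 := hQ.ode_at_node (by omega) hγ
  rw [h1, zero_mul] at h2
  have hd' : (d : ℝ) - 1 ≠ 0 := by
    have : (2 : ℝ) ≤ d := by exact_mod_cast hd
    linarith
  have hγ0 : γ ≠ 0 := by rintro rfl; norm_num at h1
  exact mul_ne_zero (mul_ne_zero hd' hγ0) hG h2.symm

end IsZonalQuadrature

/-! ### Gegenbauer polynomials and Sonine's function -/

namespace Polynomial

/-- The differential operator `p ↦ (1 - X²) p'' - c X p'`, for which the Gegenbauer polynomials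
are eigenvectors. -/
noncomputable def gegenbauerOp (c : ℝ) (p : ℝ[X]) : ℝ[X] :=
  (1 - X ^ 2) * derivative (derivative p) - C c * X * derivative p

theorem coeff_gegenbauerOp (c : ℝ) (p : ℝ[X]) (j : ℕ) :
    (gegenbauerOp c p).coeff j =
      (j + 2) * (j + 1) * p.coeff (j + 2) - j * (j + c - 1) * p.coeff j := by
  have e : gegenbauerOp c p = derivative (derivative p) - derivative (derivative p) * X ^ 2 -
      C c * (derivative p * X) := by rw [gegenbauerOp]; ring
  rw [e, coeff_sub, coeff_sub, coeff_C_mul]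
  rcases j with _ | _ | j
  · simp [coeff_derivative]
    ring
  · simp [coeff_derivative, coeff_mul_X_pow']
    ring
  · rw [coeff_mul_X_pow, coeff_mul_X]
    simp only [coeff_derivative]
    push_cast
    ring

/-- `p` satisfies the Gegenbauer differential equation of degree `m` in dimension `d`. -/
def IsGegenbauer (d m : ℕ) (p : ℝ[X]) : Prop :=
  gegenbauerOp (d - 1) p = -C ((m : ℝ) * (m + d - 2)) * p

variable {d m : ℕ} {p : ℝ[X]}

theorem IsGegenbauer.coeff_rec (h : IsGegenbauer d m p) (j : ℕ) :
    ((m : ℝ) - j) * (m + j + d - 2) * p.coeff j = -((j + 2) * (j + 1) * p.coeff (j + 2)) := by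
  have h1 := congrArg (fun q => coeff q j) h
  simp only [coeff_gegenbauerOp, neg_mul, coeff_neg, coeff_C_mul] at h1
  linear_combination h1

theorem IsGegenbauer.coeff_eq_zero (h : IsGegenbauer d m p) (hd : 2 ≤ d) (hp : p.natDegree = m)
    (i : ℕ) : ∀ j : ℕ, j + 2 * i + 1 = m → p.coeff j = 0 := by
  have hd' : (2 : ℝ) ≤ d := by exact_mod_cast hd
  induction i with
  | zero =>
    intro j hj
    have h1 := h.coeff_rec j
    rw [coeff_eq_zero_of_natDegree_lt (by omega : p.natDegree < j + 2), mul_zero, neg_zero] at h1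
    refine (mul_eq_zero.1 h1).resolve_left (mul_ne_zero ?_ ?_)
    · rw [← hj]; push_cast; norm_num
    · have : (1 : ℝ) ≤ m := by exact_mod_cast (by omega : 1 ≤ m)
      have : (0 : ℝ) ≤ j := Nat.cast_nonneg j
      linarith
  | succ i ih =>
    intro j hj
    have h1 := h.coeff_rec j
    rw [ih (j + 2) (by omega), mul_zero, neg_zero] at h1
    refine (mul_eq_zero.1 h1).resolve_left (mul_ne_zero ?_ ?_)
    · rw [sub_ne_zero]; exact_mod_cast (by omega : m ≠ j)
    · have : (1 : ℝ) ≤ m := by exact_mod_cast (by omega : 1 ≤ m)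
      have : (0 : ℝ) ≤ j := Nat.cast_nonneg j
      linarith

theorem IsGegenbauer.coeff_eq_zero_of_odd (h : IsGegenbauer d m p) (hd : 2 ≤ d)
    (hp : p.natDegree = m) {j : ℕ} (hj : Odd (m + j)) : p.coeff j = 0 := by
  rcases lt_or_ge m j with hlt | hle
  · exact coeff_eq_zero_of_natDegree_lt (hp ▸ hlt)
  · obtain ⟨k, hk⟩ := hj
    exact h.coeff_eq_zero hd hp (k - j) j (by omega)

/-- A Gegenbauer polynomial of degree `m` has the parity of `m`. -/
theorem IsGegenbauer.comp_neg_X (h : IsGegenbauer d m p) (hd : 2 ≤ d) (hp : p.natDegree = m) :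
    p.comp (-X) = C ((-1) ^ m) * p := by
  ext j
  rw [coeff_C_mul, show (-X : ℝ[X]) = C (-1) * X by simp, comp_C_mul_X_coeff]
  rcases Nat.even_or_odd (m + j) with hj | hj
  · have : (-1 : ℝ) ^ m = (-1) ^ j := by
      have h1 : (-1 : ℝ) ^ m * (-1) ^ j = 1 := by rw [← pow_add, hj.neg_one_pow]
      have h2 : (-1 : ℝ) ^ j * (-1) ^ j = 1 := by rw [← pow_add, (Even.add_self j).neg_one_pow]
      exact mul_right_cancel₀ (pow_ne_zero j (by norm_num)) (h1.trans h2.symm)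
    rw [this, mul_comm]
  · rw [h.coeff_eq_zero_of_odd hd hp hj, mul_zero, zero_mul]

/-- Sonine's function `(1 - X²) p'² + m (m + d - 2) p²`. -/
noncomputable def sonine (d m : ℕ) (p : ℝ[X]) : ℝ[X] :=
  (1 - X ^ 2) * derivative p ^ 2 + C ((m : ℝ) * (m + d - 2)) * p ^ 2

theorem IsGegenbauer.derivative_sonine (h : IsGegenbauer d m p) :
    derivative (sonine d m p) = C (2 * ((d : ℝ) - 2)) * X * derivative p ^ 2 := by
  have h' : (1 - X ^ 2) * derivative (derivative p) - C ((d : ℝ) - 1) * X * derivative p =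
    -C ((m : ℝ) * (m + d - 2)) * p := h
  have e1 : (C ((d : ℝ) - 1) : ℝ[X]) = C ((d : ℝ) - 2) + 1 := by
    rw [← C_1, ← C_add]; congr 1; ring
  have e2 : (C (2 * ((d : ℝ) - 2)) : ℝ[X]) = 2 * C ((d : ℝ) - 2) := by
    rw [C_mul]; rfl
  rw [e1] at h'
  rw [e2, sonine]
  simp only [derivative_add, derivative_mul, derivative_sub, derivative_one, derivative_pow,
    derivative_X, derivative_C]
  simp only [Nat.cast_ofNat, Nat.add_one_sub_one, pow_one, map_ofNat]
  linear_combination 2 * derivative p * h'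

/-- Sonine's function is even and strictly increasing on `[0, ∞)`. -/
theorem IsGegenbauer.sq_eq_sq_of_eval_sonine_eq (h : IsGegenbauer d m p) (hd : 3 ≤ d)
    (hp : p.natDegree = m) (hm : 1 ≤ m) {x y : ℝ}
    (hxy : (sonine d m p).eval x = (sonine d m p).eval y) : x ^ 2 = y ^ 2 := by
  have hd' : (3 : ℝ) ≤ d := by exact_mod_cast hd
  have heven : ∀ u : ℝ, (sonine d m p).eval (-u) = (sonine d m p).eval u := by
    intro u
    have hc := h.comp_neg_X (by omega) hp
    have hc' := congrArg derivative hc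
    have h1 := congrArg (eval u) hc
    have h2 := congrArg (eval u) hc'
    simp only [derivative_comp, eval_mul, eval_comp, eval_neg, eval_X, eval_C, derivative_neg,
      derivative_X, eval_one, derivative_C_mul] at h1 h2
    have h3 : ((-1 : ℝ) ^ m) ^ 2 = 1 := by rw [← pow_mul, mul_comm, pow_mul]; norm_num
    simp only [sonine, eval_add, eval_mul, eval_pow, eval_sub, eval_one, eval_X, eval_C]
    rw [h1, show (derivative p).eval (-u) = -((-1) ^ m * (derivative p).eval u) by
      linear_combination -h2]
    linear_combination ((1 - u ^ 2) * (derivative p).eval u ^ 2 +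
      m * (m + d - 2) * p.eval u ^ 2) * h3
  have habs : ∀ u : ℝ, (sonine d m p).eval |u| = (sonine d m p).eval u := by
    intro u
    rcases abs_choice u with hu | hu <;> rw [hu]
    exact heven u
  rw [← habs x, ← habs y] at hxy
  have hmono : MonotoneOn (fun u => (sonine d m p).eval u) (Set.Ici 0) := by
    refine monotoneOn_of_deriv_nonneg (convex_Ici 0) (Polynomial.continuous _).continuousOn
      (Polynomial.differentiable _).differentiableOn fun u hu => ?_
    rw [interior_Ici] at hu
    have hu' : 0 < u := hu
    rw [Polynomial.deriv, h.derivative_sonine]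
    simp only [eval_mul, eval_C, eval_X, eval_pow]
    have : 0 ≤ 2 * ((d : ℝ) - 2) := by linarith
    positivity
  have hnot : ∀ a b : ℝ, 0 ≤ a → a < b →
      (sonine d m p).eval a ≠ (sonine d m p).eval b := by
    intro a b ha hab heq
    -- a monotone polynomial that takes one value twice is constant
    have hconst : sonine d m p = C ((sonine d m p).eval a) := by
      refine Polynomial.eq_of_infinite_eval_eq _ _ ((Set.Icc_infinite hab).mono fun u hu => ?_)
      have h1 := hmono (Set.mem_Ici.2 ha) (Set.mem_Ici.2 (ha.trans hu.1)) hu.1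
      have h2 := hmono (Set.mem_Ici.2 (ha.trans hu.1)) (Set.mem_Ici.2 (ha.trans hab.le)) hu.2
      simp only at h1 h2
      simp only [Set.mem_ofPred_eq, eval_C]
      linarith
    have h0 := h.derivative_sonine
    rw [hconst, derivative_C] at h0
    have hne : (C (2 * ((d : ℝ) - 2)) * X : ℝ[X]) ≠ 0 :=
      mul_ne_zero (C_ne_zero.2 (by linarith)) X_ne_zero
    have hp' := (pow_eq_zero_iff two_ne_zero).1 ((mul_eq_zero.1 h0.symm).resolve_left hne)
    have := derivative_eq_zero.1 hp'
    omega
  rw [sq_eq_sq_iff_abs_eq_abs]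
  rcases lt_trichotomy |x| |y| with hlt | heq | hlt
  · exact (hnot _ _ (abs_nonneg x) hlt hxy).elim
  · exact heq
  · exact (hnot _ _ (abs_nonneg y) hlt hxy.symm).elim

end Polynomial

open Polynomial Lagrange in
/-- The differential equation holds at all nodes, hence identically by comparison of degrees. -/
theorem IsZonalQuadrature.isGegenbauer_nodal {d t : ℕ} {D : Finset ℝ} {n : ℝ → ℕ}
    (hQ : IsZonalQuadrature d t D n) (ht : 2 * D.card ≤ t + 1) :
    IsGegenbauer d D.card (nodal D id) := by
  rw [IsGegenbauer, ← sub_eq_zero]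
  apply eq_zero_of_degree_lt_of_eval_finset_eq_zero D
  · rw [degree_lt_iff_coeff_zero]
    intro j hj
    rw [coeff_sub, coeff_gegenbauerOp, neg_mul, coeff_neg, coeff_C_mul,
      coeff_eq_zero_of_natDegree_lt (by rw [natDegree_nodal]; omega : _ < j + 2)]
    rcases hj.lt_or_eq with hlt | rfl
    · rw [coeff_eq_zero_of_natDegree_lt (by rw [natDegree_nodal]; omega : _ < j)]
      ring
    · ring
  · intro α hα
    have h0 : (nodal D id).eval α = 0 := eval_nodal_at_node (v := id) hα
    have h1 := hQ.ode_at_node ht hα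
    simp only [gegenbauerOp, eval_sub, eval_mul, eval_one, eval_pow, eval_X, eval_C, h0]
    rw [h1]
    ring

/-! ### Denominators -/

/-- The coefficient of `u^n` in `(∑ k, centralBinom k * u^k)^e = (1 - 4u)^(-e/2)`. -/
noncomputable def centralBinomPowCoeff (e n : ℕ) : ℕ :=
  PowerSeries.coeff n ((PowerSeries.mk Nat.centralBinom) ^ e)

open PowerSeries in
/-- The power `f = (1 - 4u)^(-e/2)` satisfies `f' = 4u f' + 2e f`, written without subtraction. -/
theorem derivative_mk_centralBinom_pow (e : ℕ) :
    d⁄dX ℕ ((PowerSeries.mk Nat.centralBinom) ^ e) =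
      4 * X * d⁄dX ℕ ((PowerSeries.mk Nat.centralBinom) ^ e) +
        (2 * e : ℕ⟦X⟧) * (PowerSeries.mk Nat.centralBinom) ^ e := by
  set f : ℕ⟦X⟧ := PowerSeries.mk Nat.centralBinom with hf
  have h1 : d⁄dX ℕ f = 4 * X * d⁄dX ℕ f + 2 * f := by
    ext n
    have e4 : (4 : ℕ⟦X⟧) = C (4 : ℕ) := rfl
    have e2 : (2 : ℕ⟦X⟧) = C (2 : ℕ) := rfl
    rw [e4, e2, map_add, mul_assoc, coeff_C_mul, coeff_C_mul, coeff_derivative, hf, coeff_mk,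
      coeff_mk]
    have h := Nat.succ_mul_centralBinom_succ n
    rcases n with _ | n
    · simp at h ⊢; simpa using h
    · rw [mul_comm X, coeff_succ_mul_X, coeff_derivative, coeff_mk]
      simp only [Nat.cast_id]
      linarith
  induction e with
  | zero => simp
  | succ e ih =>
    rw [pow_succ, Derivation.leibniz]
    simp only [smul_eq_mul]
    calc f ^ e * d⁄dX ℕ f + f * d⁄dX ℕ (f ^ e)
        = f ^ e * (4 * X * d⁄dX ℕ f + 2 * f) +
          f * (4 * X * d⁄dX ℕ (f ^ e) + (2 * e : ℕ⟦X⟧) * f ^ e) := by rw [← h1, ← ih]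
      _ = _ := by push_cast; ring

theorem centralBinomPowCoeff_zero (e : ℕ) : centralBinomPowCoeff e 0 = 1 := by
  rw [centralBinomPowCoeff, PowerSeries.coeff_zero_eq_constantCoeff, map_pow]
  simp

open PowerSeries in
theorem succ_mul_centralBinomPowCoeff_succ (e n : ℕ) :
    (n + 1) * centralBinomPowCoeff e (n + 1) = (4 * n + 2 * e) * centralBinomPowCoeff e n := by
  have h := congrArg (coeff n) (derivative_mk_centralBinom_pow e)
  have e4 : (4 : ℕ⟦X⟧) = C (4 : ℕ) := rfl
  have e2 : (2 * e : ℕ⟦X⟧) = C (2 * e : ℕ) := by simp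
  rw [e4, e2, map_add, mul_assoc, coeff_C_mul, coeff_C_mul, coeff_derivative] at h
  simp only [centralBinomPowCoeff]
  rcases n with _ | n
  · simp at h ⊢
    linarith
  · rw [mul_comm X, coeff_succ_mul_X, coeff_derivative] at h
    simp only [Nat.cast_id] at h
    linarith

theorem centralBinomPowCoeff_le (d n : ℕ) (hd : 2 ≤ d) :
    centralBinomPowCoeff (d - 2) n ≤ (2 * d) ^ n := by
  induction n with
  | zero => simp [centralBinomPowCoeff_zero]
  | succ n ih =>
    have h := succ_mul_centralBinomPowCoeff_succ (d - 2) n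
    have h1 : 4 * n + 2 * (d - 2) ≤ (n + 1) * (2 * d) := by
      have : 2 * n ≤ d * n := Nat.mul_le_mul_right n hd
      calc 4 * n + 2 * (d - 2) ≤ 2 * (2 * n) + 2 * d := by omega
        _ ≤ 2 * (d * n) + 2 * d := by omega
        _ = (n + 1) * (2 * d) := by ring
    refine Nat.le_of_mul_le_mul_left (c := n + 1) ?_ n.succ_pos
    rw [h, pow_succ]
    calc _ ≤ (n + 1) * (2 * d) * (2 * d) ^ n := Nat.mul_le_mul h1 ih
      _ = _ := by ring

theorem centralBinomPowCoeff_pos (d n : ℕ) (hd : 3 ≤ d) :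
    0 < centralBinomPowCoeff (d - 2) n := by
  induction n with
  | zero => simp [centralBinomPowCoeff_zero]
  | succ n ih =>
    have h := succ_mul_centralBinomPowCoeff_succ (d - 2) n
    have h1 : 0 < (4 * n + 2 * (d - 2)) * centralBinomPowCoeff (d - 2) n :=
      Nat.mul_pos (by omega) ih
    rw [← h] at h1
    exact Nat.pos_of_mul_pos_left h1

namespace Polynomial

variable {d m : ℕ} {p : ℝ[X]}

/-- The coefficients of the monic Gegenbauer polynomial, multiplied by a common denominator. -/
theorem IsGegenbauer.centralBinomPowCoeff_mul_coeff (h : IsGegenbauer d m p) (hd : 3 ≤ d)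
    (hp : p.natDegree = m) (hmonic : p.Monic) (i : ℕ) : ∀ j : ℕ, j + 2 * i = m →
    (centralBinomPowCoeff (d - 2) m : ℝ) * p.coeff j =
      (-1) ^ i * ((m - i).choose i * centralBinomPowCoeff (d - 2) (m - i) : ℕ) := by
  have hd' : (3 : ℝ) ≤ d := by exact_mod_cast hd
  induction i with
  | zero =>
    intro j hj
    have hj' : j = p.natDegree := by omega
    have hlead : p.coeff j = 1 := by rw [hj']; exact hmonic
    simp [hlead]
  | succ i ih =>
    intro j hj
    have h1 := h.coeff_rec j
    have h2 := ih (j + 2) (by omega)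
    obtain ⟨N, hN⟩ : ∃ N, N = j + i + 1 := ⟨_, rfl⟩
    rw [show m - i = N + 1 by omega] at h2
    rw [show m - (i + 1) = N by omega]
    have hm : (m : ℝ) = j + 2 * (i + 1) := by rw [← hj]; push_cast; ring
    have hNr : (N : ℝ) = j + i + 1 := by rw [hN]; push_cast; ring
    have hF : ((N : ℝ) + 1) * centralBinomPowCoeff (d - 2) (N + 1) =
        (4 * N + 2 * (d - 2)) * centralBinomPowCoeff (d - 2) N := by
      have := succ_mul_centralBinomPowCoeff_succ (d - 2) N
      have := congrArg (Nat.cast : ℕ → ℝ) this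
      push_cast [Nat.cast_sub (by omega : 2 ≤ d)] at this
      exact this
    have hc : ((i : ℝ) + 1) * (N + 1) * N.choose (i + 1) =
        (j + 2) * (j + 1) * (N + 1).choose i := by
      have a1 := Nat.choose_succ_right_eq N i
      have a2 := Nat.choose_mul_succ_eq N i
      rw [show N - i = j + 1 by omega] at a1
      rw [show N + 1 - i = j + 2 by omega] at a2
      have b1 := congrArg (Nat.cast : ℕ → ℝ) a1
      have b2 := congrArg (Nat.cast : ℕ → ℝ) a2
      push_cast at b1 b2
      linear_combination ((N : ℝ) + 1) * b1 + ((j : ℝ) + 1) * b2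
    have hne : ((m : ℝ) - j) * (m + j + d - 2) ≠ 0 := by
      apply ne_of_gt
      have : (0 : ℝ) ≤ j := Nat.cast_nonneg j
      have : (0 : ℝ) ≤ i := Nat.cast_nonneg i
      apply mul_pos <;> rw [hm] <;> linarith
    apply mul_left_cancel₀ hne
    push_cast at h2 ⊢
    have h3 : ((m : ℝ) - j) * (m + j + d - 2) = (2 * i + 2) * (2 * N + (d - 2)) := by
      rw [hm, hNr]; ring
    have h4 : (-1 : ℝ) ^ (i + 1) = -(-1) ^ i := by rw [pow_succ]; ring
    rw [h4]
    calc _ = (centralBinomPowCoeff (d - 2) m : ℝ) *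
          (((m : ℝ) - j) * (m + j + d - 2) * p.coeff j) := by ring
      _ = _ := by
        rw [h1, h3]
        linear_combination (-((j : ℝ) + 2) * (j + 1)) * h2 -
          (-1 : ℝ) ^ i * centralBinomPowCoeff (d - 2) (N + 1) * hc * (-1) -
          (-1 : ℝ) ^ i * (i + 1) * N.choose (i + 1) * hF

theorem IsGegenbauer.exists_int_coeff (h : IsGegenbauer d m p) (hd : 3 ≤ d)
    (hp : p.natDegree = m) (hmonic : p.Monic) (j : ℕ) :
    ∃ a : ℤ, (a : ℝ) = (centralBinomPowCoeff (d - 2) m : ℝ) * p.coeff j := by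
  rcases Nat.even_or_odd (m + j) with hj | hj
  · rcases lt_or_ge m j with hlt | hle
    · exact ⟨0, by rw [coeff_eq_zero_of_natDegree_lt (hp ▸ hlt)]; simp⟩
    · obtain ⟨k, hk⟩ := hj
      refine ⟨(-1) ^ (k - j) *
        ((m - (k - j)).choose (k - j) * centralBinomPowCoeff (d - 2) (m - (k - j)) : ℕ), ?_⟩
      rw [h.centralBinomPowCoeff_mul_coeff hd hp hmonic (k - j) j (by omega)]
      push_cast
      ring
  · exact ⟨0, by rw [h.coeff_eq_zero_of_odd (by omega) hp hj]; simp⟩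

/-- An integer polynomial whose roots include the squares of the roots of the monic Gegenbauer
polynomial `p`, and whose leading coefficient grows at most exponentially with the degree. -/
theorem IsGegenbauer.exists_int_polynomial_sq (h : IsGegenbauer d m p) (hd : 3 ≤ d)
    (hp : p.natDegree = m) (hmonic : p.Monic) :
    ∃ R : ℤ[X], R.leadingCoeff = centralBinomPowCoeff (d - 2) m ∧
      ∀ x : ℝ, p.eval x = 0 → aeval (x ^ 2) R = 0 := by
  set F := centralBinomPowCoeff (d - 2) m with hF
  have hF0 : (F : ℝ) ≠ 0 := by exact_mod_cast (centralBinomPowCoeff_pos d m hd).ne'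
  obtain ⟨P, hP⟩ := (mem_lifts (f := Int.castRingHom ℝ) (C (F : ℝ) * p)).1
    ((lifts_iff_coeff_lifts _).2 fun j => by
      obtain ⟨a, ha⟩ := h.exists_int_coeff hd hp hmonic j
      exact ⟨a, by rw [coeff_C_mul]; exact ha⟩)
  have hinj : Function.Injective (Int.castRingHom ℝ) := Int.cast_injective
  have hPlead : P.leadingCoeff = F := by
    apply hinj
    rw [← leadingCoeff_map_of_injective hinj, hP, leadingCoeff_mul, leadingCoeff_C,
      hmonic.leadingCoeff]
    simp
  -- `X ^ m * P` is even because `P` has the parity of `m`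
  have hexp : expand ℤ 2 (contract 2 (P * X ^ m)) = P * X ^ m := by
    ext j
    rw [coeff_expand two_pos, coeff_contract two_ne_zero]
    split_ifs with hj
    · rw [Nat.div_mul_cancel hj]
    · rw [coeff_mul_X_pow']
      split_ifs with hmj
      · apply hinj
        have h1 := congrArg (fun q => coeff q (j - m)) hP
        simp only [coeff_map, coeff_C_mul] at h1
        rw [h1, h.coeff_eq_zero_of_odd (by omega) hp]
        · simp
        · rw [show m + (j - m) = j by omega]
          exact Nat.not_even_iff_odd.1 fun he => hj he.two_dvd
      · rfl
  refine ⟨contract 2 (P * X ^ m), ?_, fun x hx => ?_⟩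
  · rw [← leadingCoeff_expand (p := 2) two_pos, hexp, leadingCoeff_mul_X_pow, hPlead]
  · rw [← expand_aeval, hexp, map_mul]
    have h1 : aeval x P = 0 := by
      rw [aeval_def, algebraMap_int_eq, eval₂_eq_eval_map, hP, eval_mul, hx, mul_zero]
    rw [h1, zero_mul]

end Polynomial

open Polynomial in
/-- By Gauss's lemma the primitive linear polynomials belonging to distinct rational roots of an
integer polynomial can be split off one after the other. -/
theorem prod_den_dvd_leadingCoeff (S : Finset ℚ) :
    ∀ R : ℤ[X], (∀ r ∈ S, aeval r R = 0) → (∏ r ∈ S, (r.den : ℤ)) ∣ R.leadingCoeff := by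
  induction S using Finset.induction_on with
  | empty => simp
  | insert r S hr ih =>
    intro R hR
    set L : ℤ[X] := C (r.den : ℤ) * X - C r.num with hL
    have hprim : L.IsPrimitive := by
      intro c hc
      rw [C_dvd_iff_dvd_coeff] at hc
      have h0 : c ∣ r.num := by simpa [hL, coeff_C] using hc 0
      have h1 : c ∣ (r.den : ℤ) := by simpa [hL, coeff_C, -eq_intCast, -Int.cast_eq] using hc 1
      exact (Rat.isCoprime_num_den r).isUnit_of_dvd' h0 h1
    have hden : (r.den : ℚ) ≠ 0 := by exact_mod_cast r.den_nz
    have hLmap : L.map (algebraMap ℤ ℚ) = C (r.den : ℚ) * (X - C r) := by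
      simp only [hL, Polynomial.map_sub, Polynomial.map_mul, map_C, map_X, mul_sub, ← C_mul]
      simp [Rat.den_mul_eq_num]
    obtain ⟨Q, rfl⟩ : L ∣ R := by
      refine hprim.dvd_of_fraction_map_dvd_fraction_map (K := ℚ) ?_
      rw [hLmap, IsUnit.mul_left_dvd (isUnit_C.2 hden.isUnit), dvd_iff_isRoot, IsRoot.def,
        ← eval₂_eq_eval_map, ← aeval_def]
      exact hR r (Finset.mem_insert_self _ _)
    have hLlead : L.leadingCoeff = r.den := by
      rw [hL, leadingCoeff_sub_of_degree_lt]
      · rw [leadingCoeff_mul_X, leadingCoeff_C]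
      · rw [degree_C_mul_X (by exact_mod_cast r.den_nz)]
        exact degree_C_le.trans_lt (by norm_num)
    rw [Finset.prod_insert hr, leadingCoeff_mul, hLlead]
    refine mul_dvd_mul_left _ (ih Q fun s hs => ?_)
    have h := hR s (Finset.mem_insert_of_mem hs)
    rw [map_mul] at h
    refine (mul_eq_zero.1 h).resolve_left fun h0 => hr ?_
    rw [aeval_def, eval₂_eq_eval_map, hLmap] at h0
    simp only [eval_mul, eval_C, eval_sub, eval_X] at h0
    have := sub_eq_zero.1 ((mul_eq_zero.1 h0).resolve_left hden)
    rwa [this] at hs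

/-- Only boundedly many rationals in `[0, 1]` have denominator at most `K`, so a product of
denominators over a set of such rationals grows faster than exponentially. -/
theorem card_le_of_prod_den_le {S : Finset ℚ} (hS : ∀ r ∈ S, 0 ≤ r ∧ r ≤ 1) {c m : ℕ}
    (hc : 2 ≤ c) (hm : m ≤ 2 * S.card) (hprod : ∏ r ∈ S, r.den ≤ c ^ m) :
    m ≤ 6 * (c ^ 3 + 1) ^ 2 := by
  -- if more than two thirds of the denominators exceed `c ^ 3`, their product exceeds `c ^ m`
  set K := c ^ 3 with hK
  have hsmall : (S.filter fun r => r.den ≤ K).card ≤ (K + 1) ^ 2 := by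
    have : (K + 1) ^ 2 = ((Finset.range (K + 1)) ×ˢ (Finset.range (K + 1))).card := by
      simp [sq]
    rw [this]
    refine Finset.card_le_card_of_injOn (fun r => (r.num.toNat, r.den)) ?_ ?_
    · intro r hr
      obtain ⟨hrS, hrK⟩ := Finset.mem_filter.1 hr
      have h1 : r.num ≤ r.den := by
        have := (hS r hrS).2
        rw [Rat.le_iff] at this
        simpa using this
      simp only [Finset.coe_product, Finset.coe_range, Set.mem_prod, Set.mem_Iio]
      omega
    · intro r hr s hs hrs
      have hr0 := Rat.num_nonneg.2 (hS r (Finset.mem_filter.1 hr).1).1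
      have hs0 := Rat.num_nonneg.2 (hS s (Finset.mem_filter.1 hs).1).1
      simp only [Prod.mk.injEq] at hrs
      exact Rat.ext (by omega) hrs.2
  have hlarge : K ^ (S.filter fun r => ¬ r.den ≤ K).card ≤ c ^ m := by
    refine le_trans ?_ hprod
    rw [← Finset.prod_filter_mul_prod_filter_not S (fun r => r.den ≤ K)]
    have h1 : 1 ≤ ∏ r ∈ S.filter (fun r => r.den ≤ K), r.den :=
      Finset.prod_pos fun (r : ℚ) _ => r.den_pos
    have h2 : K ^ (S.filter fun r => ¬ r.den ≤ K).card ≤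
        ∏ r ∈ S.filter (fun r => ¬ r.den ≤ K), r.den :=
      Finset.pow_card_le_prod _ _ _ fun r hr => (not_le.1 (Finset.mem_filter.1 hr).2).le
    calc _ ≤ _ := h2
      _ ≤ _ := Nat.le_mul_of_pos_left _ h1
  have hexp := hlarge
  rw [show K ^ (S.filter fun r => ¬ r.den ≤ K).card =
    c ^ (3 * (S.filter fun r => ¬ r.den ≤ K).card) by rw [hK, ← pow_mul],
    Nat.pow_le_pow_iff_right hc] at hexp
  have hsplit := Finset.card_filter_add_card_filter_not (s := S) (fun r => r.den ≤ K)
  omega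

/-! ### Rationality of the squared nodes -/

open Polynomial in
/-- A real number all of whose conjugates are real and equal to it up to sign has rational
square. -/
theorem exists_rat_sq_of_conjugates {α : ℝ} {G : ℚ[X]} (hG : G.Monic)
    (hsplitsG : (G.map (algebraMap ℚ ℝ)).Splits) (hGα : aeval α G = 0)
    (hconj : ∀ β : ℝ, aeval β (minpoly ℚ α) = 0 → β = α ∨ β = -α) :
    ∃ q : ℚ, α ^ 2 = (q : ℝ) := by
  have hint : IsIntegral ℚ α := ⟨G, hG, hGα⟩
  set f := minpoly ℚ α with hf
  have hfmonic : f.Monic := minpoly.monic hint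
  have hsplits : (f.map (algebraMap ℚ ℝ)).Splits :=
    Splits.of_dvd hsplitsG (hG.map _).ne_zero (Polynomial.map_dvd _ (minpoly.dvd ℚ α hGα))
  have hsep : (f.map (algebraMap ℚ ℝ)).Separable :=
    (minpoly.irreducible hint).separable.map
  have hnodup := nodup_roots hsep
  have hmem : ∀ β ∈ (f.map (algebraMap ℚ ℝ)).roots, aeval β f = 0 := by
    intro β hβ
    rw [aeval_def, eval₂_eq_eval_map]
    exact (mem_roots'.1 hβ).2
  have hdegroots : f.natDegree = (f.map (algebraMap ℚ ℝ)).roots.toFinset.card := by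
    rw [Multiset.toFinset_card_of_nodup hnodup, ← hsplits.natDegree_eq_card_roots, natDegree_map]
  have hsub : (f.map (algebraMap ℚ ℝ)).roots.toFinset ⊆ {α, -α} := by
    intro β hβ
    simpa using hconj β (hmem β (Multiset.mem_toFinset.1 hβ))
  have hαroot : aeval α f = 0 := minpoly.aeval ℚ α
  have hfpos : 0 < f.natDegree := minpoly.natDegree_pos hint
  -- either `±α` are two distinct roots, and `f = X² - α²`, or `α` is the only root and is rational
  by_cases hneg : aeval (-α) f = 0 ∧ α ≠ 0
  · obtain ⟨hneg, hα0⟩ := hneg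
    have hle : f.natDegree ≤ 2 := by
      rw [hdegroots]
      exact (Finset.card_le_card hsub).trans Finset.card_le_two
    rw [aeval_eq_sum_range' (by omega : f.natDegree < 3)] at hneg hαroot
    simp only [Finset.sum_range_succ, Finset.sum_range_zero, Rat.smul_def] at hneg hαroot
    have h1 : (f.coeff 1 : ℝ) * α = 0 := by linear_combination (hαroot - hneg) / 2
    have h1' := (mul_eq_zero.1 h1).resolve_right hα0
    have hdeg2 : f.natDegree = 2 := by
      by_contra hne
      have h11 : f.natDegree = 1 := by omega
      have : f.coeff 1 = 1 := by rw [← h11]; exact hfmonic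
      rw [this] at h1'
      norm_num at h1'
    have h2 : f.coeff 2 = 1 := by rw [← hdeg2]; exact hfmonic
    rw [h2, h1'] at hαroot
    refine ⟨-f.coeff 0, ?_⟩
    push_cast at hαroot ⊢
    linear_combination hαroot
  · have hone : (f.map (algebraMap ℚ ℝ)).roots.toFinset ⊆ {α} := by
      intro β hβ
      have hβ0 := hmem β (Multiset.mem_toFinset.1 hβ)
      rcases hconj β hβ0 with rfl | rfl
      · simp
      · have : α = 0 := by
          by_contra h
          exact hneg ⟨hβ0, h⟩
        simp [this]
    have hdeg1 : f.natDegree = 1 := by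
      have := Finset.card_le_card hone
      rw [← hdegroots, Finset.card_singleton] at this
      omega
    obtain ⟨q, hq⟩ := minpoly.natDegree_eq_one_iff.1 hdeg1
    refine ⟨q ^ 2, ?_⟩
    push_cast
    rw [← hq]
    simp

namespace IsZonalQuadrature

open Polynomial Lagrange

variable {d t : ℕ} {D : Finset ℝ} {n : ℝ → ℕ}

theorem exists_rat_moment (hQ : IsZonalQuadrature d t D n) (hd : 2 ≤ d) (k : ℕ) (hk : k ≤ t) :
    ∃ q : ℚ, ∑ γ ∈ D, n γ * γ ^ k = (q : ℝ) := by
  have hd' : (2 : ℝ) ≤ d := by exact_mod_cast hd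
  induction k using Nat.twoStepInduction with
  | zero => exact ⟨∑ γ ∈ D, (n γ : ℚ), by push_cast; simp⟩
  | one =>
    have h := hQ.sum_eq_zero 1 (by simpa using hk)
    refine ⟨0, ?_⟩
    simp only [eval_zonalDivergence, derivative_one, eval_zero, mul_zero, zero_sub, eval_one,
      mul_one, mul_neg, Finset.sum_neg_distrib, neg_eq_zero] at h
    simp_rw [mul_left_comm _ ((d : ℝ) - 1)] at h
    rw [← Finset.mul_sum] at h
    simpa using (mul_eq_zero.1 h).resolve_left (by linarith)
  | more k ih _ =>
    obtain ⟨q, hq⟩ := ih (by omega)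
    have h := hQ.sum_eq_zero (X ^ (k + 1)) (by rw [natDegree_X_pow]; omega)
    have e : ∀ γ : ℝ, n γ * (zonalDivergence (d - 1) (X ^ (k + 1) : ℝ[X])).eval γ =
        (k + 1) * (n γ * γ ^ k) - (k + d) * (n γ * γ ^ (k + 2)) := by
      intro γ
      rw [eval_zonalDivergence]
      simp only [derivative_X_pow, eval_mul, eval_pow, eval_X, eval_C]
      push_cast
      ring
    simp_rw [e] at h
    rw [Finset.sum_sub_distrib, ← Finset.mul_sum, ← Finset.mul_sum, hq] at h
    have hne : (k : ℝ) + d ≠ 0 := by positivity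
    refine ⟨(k + 1) * q / (k + d), ?_⟩
    push_cast
    rw [eq_div_iff hne]
    linarith

/-- Modulo the nodal polynomial every rational polynomial has degree within the range where the
moments are known to be rational. -/
theorem exists_rat_sum_aeval (hQ : IsZonalQuadrature d t D n) (hd : 2 ≤ d)
    (ht : D.card ≤ t + 1) {G : ℚ[X]} (hG : G.map (algebraMap ℚ ℝ) = nodal D id) (P : ℚ[X]) :
    ∃ q : ℚ, ∑ γ ∈ D, n γ * aeval γ P = (q : ℝ) := by
  have hmonic : G.Monic := by
    apply monic_of_injective (algebraMap ℚ ℝ).injective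
    rw [hG]; exact nodal_monic
  have hdeg : G.natDegree = D.card := by
    rw [← natDegree_map (algebraMap ℚ ℝ), hG, natDegree_nodal]
  set r := P %ₘ G with hr
  have hred : ∀ γ ∈ D, aeval γ P = aeval γ r := by
    intro γ hγ
    have hG0 : aeval γ G = 0 := by
      rw [aeval_def, eval₂_eq_eval_map, hG]
      exact eval_nodal_at_node (v := id) hγ
    rw [← modByMonic_add_div P G, map_add, map_mul, hG0, zero_mul, add_zero]
  have hrdeg : ∀ j ∈ Finset.range (r.natDegree + 1), r.coeff j ≠ 0 → j ≤ t := by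
    intro j _ hj0
    have h1 : (r.degree : WithBot ℕ) < G.degree := degree_modByMonic_lt P hmonic
    have h2 : (j : WithBot ℕ) ≤ r.degree := le_degree_of_ne_zero hj0
    have h3 := h2.trans_lt h1
    rw [degree_eq_natDegree hmonic.ne_zero, hdeg] at h3
    have : j < D.card := by exact_mod_cast h3
    omega
  have hterm : ∀ j ∈ Finset.range (r.natDegree + 1),
      ∃ q : ℚ, ∑ γ ∈ D, n γ * ((r.coeff j : ℝ) * γ ^ j) = (q : ℝ) := by
    intro j hj
    by_cases h0 : r.coeff j = 0
    · exact ⟨0, by simp [h0]⟩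
    · obtain ⟨q, hq⟩ := hQ.exists_rat_moment hd j (hrdeg j hj h0)
      refine ⟨r.coeff j * q, ?_⟩
      simp_rw [mul_left_comm _ ((r.coeff j : ℚ) : ℝ)]
      rw [← Finset.mul_sum, hq]
      push_cast
      ring
  choose! q hq using hterm
  refine ⟨∑ j ∈ Finset.range (r.natDegree + 1), q j, ?_⟩
  rw [Finset.sum_congr rfl fun γ hγ => by rw [hred γ hγ, aeval_eq_sum_range]]
  simp_rw [Finset.mul_sum]
  rw [Finset.sum_comm]
  push_cast
  refine Finset.sum_congr rfl fun j hj => ?_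
  rw [← hq j hj]
  refine Finset.sum_congr rfl fun γ _ => ?_
  rw [Rat.smul_def]

/-- The squares of the nodes are rational. Let `G` be the nodal polynomial. Since `n α` and
`n α (1 - α²) G'(α)²` are rational, `(1 - α²) G'(α)²` takes the same value at all conjugates of a
node `α`; by monotonicity of Sonine's function these are among `α` and `-α`. -/
theorem exists_rat_sq (hQ : IsZonalQuadrature d t D n) (hd : 3 ≤ d)
    (ht : 2 * D.card ≤ t + 1) {α : ℝ} (hα : α ∈ D) : ∃ q : ℚ, α ^ 2 = (q : ℝ) := by
  have hcard : 1 ≤ D.card := Finset.card_pos.2 ⟨α, hα⟩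
  have hgeg := hQ.isGegenbauer_nodal ht
  have hndeg : (nodal D (id : ℝ → ℝ)).natDegree = D.card := natDegree_nodal
  have hmonic : (nodal D (id : ℝ → ℝ)).Monic := nodal_monic
  have hF0 : (centralBinomPowCoeff (d - 2) D.card : ℝ) ≠ 0 := by
    exact_mod_cast (centralBinomPowCoeff_pos d D.card hd).ne'
  obtain ⟨G, hG⟩ := (mem_lifts (f := algebraMap ℚ ℝ) (nodal D id)).1
    ((lifts_iff_coeff_lifts _).2 fun j => by
      obtain ⟨a, ha⟩ := hgeg.exists_int_coeff hd hndeg hmonic j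
      refine ⟨a / centralBinomPowCoeff (d - 2) D.card, ?_⟩
      simp only [eq_ratCast]
      push_cast
      rw [ha, mul_div_cancel_left₀ _ hF0])
  set W : ℚ[X] := (1 - X ^ 2) * derivative G ^ 2 with hW
  have hWeval : ∀ γ : ℝ, aeval γ W = (1 - γ ^ 2) * (derivative (nodal D id)).eval γ ^ 2 := by
    intro γ
    rw [← hG, derivative_map, hW, eval_map_algebraMap]
    simp
  obtain ⟨κ, hκ⟩ := hQ.exists_rat_sum_aeval (by omega) (by omega) hG W
  have hsum : ∑ γ ∈ D, n γ * aeval γ W = D.card * (n α * aeval α W) := by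
    rw [← nsmul_eq_mul, ← Finset.sum_const]
    refine Finset.sum_congr rfl fun γ hγ => ?_
    rw [hWeval, hWeval]
    exact hQ.weight_mul_eq ht hγ hα
  have hnα : (n α : ℝ) ≠ 0 := by exact_mod_cast (hQ.pos α hα).ne'
  have hc0 : (D.card : ℝ) ≠ 0 := by exact_mod_cast (by omega : D.card ≠ 0)
  set v : ℚ := κ / (D.card * n α) with hv
  have hWα : aeval α W = (v : ℝ) := by
    rw [hv]
    push_cast
    rw [← hκ, hsum]
    field_simp
  have hGα : ∀ γ ∈ D, aeval γ G = 0 := by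
    intro γ hγ
    rw [aeval_def, eval₂_eq_eval_map, hG]
    exact eval_nodal_at_node (v := id) hγ
  have hGmonic : G.Monic := by
    apply monic_of_injective (algebraMap ℚ ℝ).injective
    rw [hG]; exact hmonic
  have hint : IsIntegral ℚ α := ⟨G, hGmonic, hGα α hα⟩
  set f := minpoly ℚ α with hf
  have hfG : f ∣ G := minpoly.dvd ℚ α (hGα α hα)
  have hfW : f ∣ W - C v := minpoly.dvd ℚ α (by rw [map_sub, hWα]; simp)
  have hconj : ∀ β : ℝ, aeval β f = 0 → β = α ∨ β = -α := by
    intro β hβ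
    have h1 : aeval β G = 0 := by
      obtain ⟨g, hg⟩ := hfG
      rw [hg, map_mul, hβ, zero_mul]
    have h2 : aeval β W = (v : ℝ) := by
      obtain ⟨g, hg⟩ := hfW
      have := congrArg (aeval β) hg
      rw [map_mul, hβ, zero_mul, map_sub, sub_eq_zero] at this
      simpa using this
    rw [aeval_def, eval₂_eq_eval_map, hG] at h1
    have h3 : (nodal D id).eval α = 0 := eval_nodal_at_node (v := id) hα
    rw [hWeval] at hWα h2
    rw [← sq_eq_sq_iff_eq_or_eq_neg]
    refine hgeg.sq_eq_sq_of_eval_sonine_eq hd hndeg hcard ?_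
    simp only [sonine, eval_add, eval_mul, eval_sub, eval_one, eval_pow, eval_X, eval_C, h1,
      h3, hWα, h2]
  have hsplits : (G.map (algebraMap ℚ ℝ)).Splits := by
    rw [hG, nodal_eq]
    exact Splits.prod fun i _ => Splits.X_sub_C _
  exact exists_rat_sq_of_conjugates hGmonic hsplits (hGα α hα) hconj

/-- The number of nodes of a zonal quadrature formula of Gauss type with integral weights is
bounded in terms of the dimension. -/
theorem card_le (hQ : IsZonalQuadrature d t D n) (hd : 3 ≤ d) (ht : 2 * D.card ≤ t + 1)
    (hI : ∀ γ ∈ D, γ ^ 2 ≤ 1) : D.card ≤ 6 * ((2 * d) ^ 3 + 1) ^ 2 := by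
  have hrat : ∀ γ : ℝ, ∃ q : ℚ, γ ∈ D → γ ^ 2 = (q : ℝ) := by
    intro γ
    by_cases hγ : γ ∈ D
    · obtain ⟨q, hq⟩ := hQ.exists_rat_sq hd ht hγ
      exact ⟨q, fun _ => hq⟩
    · exact ⟨0, fun h => (hγ h).elim⟩
  choose q hq using hrat
  obtain ⟨R, hRlead, hR⟩ := (hQ.isGegenbauer_nodal ht).exists_int_polynomial_sq hd
    natDegree_nodal nodal_monic
  have hdvd := prod_den_dvd_leadingCoeff (D.image q) R (by
    intro r hr
    obtain ⟨γ, hγ, rfl⟩ := Finset.mem_image.1 hr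
    have h1 := hR γ (eval_nodal_at_node (v := id) hγ)
    rw [hq γ hγ] at h1
    have h2 := aeval_algebraMap_apply ℝ (q γ) R
    rw [eq_ratCast, h1, eq_ratCast] at h2
    exact_mod_cast h2.symm)
  rw [hRlead] at hdvd
  refine card_le_of_prod_den_le (S := D.image q) ?_ (by omega) ?_ ?_
  · intro r hr
    obtain ⟨γ, hγ, rfl⟩ := Finset.mem_image.1 hr
    have h1 := hI γ hγ
    have h2 := sq_nonneg γ
    rw [hq γ hγ] at h1 h2
    exact ⟨by exact_mod_cast h2, by exact_mod_cast h1⟩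
  · refine Finset.card_le_mul_card_image (f := q) D 2 fun r _ => ?_
    by_cases hne : (D.filter fun γ => q γ = r).Nonempty
    · obtain ⟨γ, hγ⟩ := hne
      obtain ⟨hγD, hγr⟩ := Finset.mem_filter.1 hγ
      refine (Finset.card_le_card (t := ({γ, -γ} : Finset ℝ)) fun β hβ => ?_).trans
        Finset.card_le_two
      obtain ⟨hβD, hβr⟩ := Finset.mem_filter.1 hβ
      have : β ^ 2 = γ ^ 2 := by rw [hq β hβD, hq γ hγD, hγr, hβr]
      simpa using sq_eq_sq_iff_eq_or_eq_neg.1 this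
    · rw [Finset.not_nonempty_iff_eq_empty.1 hne]
      simp
  · refine (Nat.le_of_dvd (centralBinomPowCoeff_pos d D.card hd) ?_).trans
      (centralBinomPowCoeff_le d D.card (by omega))
    exact_mod_cast hdvd

end IsZonalQuadrature

/-! ### Stiff configurations -/

/-- In a fixed dimension `d ≥ 3` there are only finitely many `m` for which `m`-stiff configurations
exist. The weight of a node is the number of points of `X` in the corresponding hyperplane. -/
theorem IsStiff.le {d m : ℕ} (hd : 3 ≤ d) {X : Finset (UnitSphere d)} (hX : IsStiff m X) :
    m ≤ 6 * ((2 * d) ^ 3 + 1) ^ 2 := by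
  obtain ⟨hm, hdes, z, hz⟩ := hX
  set s : UnitSphere d → ℝ := fun x =>
    inner ℝ (z : EuclideanSpace ℝ (Fin d)) (x : EuclideanSpace ℝ (Fin d)) with hs
  set D : Finset ℝ := X.image s with hD
  have hDset : innerProducts z X = (D : Set ℝ) := by
    ext u
    simp [innerProducts, hD, hs, eq_comm]
  rw [Set.mem_ofPred_eq, hDset, Set.ncard_coe_finset] at hz
  have hQ : IsZonalQuadrature d (2 * m - 1) D fun γ => (X.filter fun x => s x = γ).card := by
    refine ⟨fun γ hγ => ?_, fun p hp => ?_⟩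
    · obtain ⟨x, hx, hxγ⟩ := Finset.mem_image.1 hγ
      exact Finset.card_pos.2 ⟨x, Finset.mem_filter.2 ⟨hx, hxγ⟩⟩
    · have h := hdes.sum_zonalDivergence (by omega) z p hp
      change ∑ x ∈ X, (zonalDivergence (d - 1) p).eval (s x) = 0 at h
      rw [Finset.sum_comp (fun u => (zonalDivergence (d - 1) p).eval u) s] at h
      simpa only [nsmul_eq_mul] using h
  have hI : ∀ γ ∈ D, γ ^ 2 ≤ 1 := by
    intro γ hγ
    obtain ⟨x, -, rfl⟩ := Finset.mem_image.1 hγ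
    rw [sq_le_one_iff_abs_le_one]
    simpa using abs_real_inner_le_norm (z : EuclideanSpace ℝ (Fin d))
      (x : EuclideanSpace ℝ (Fin d))
  have hle := hQ.le_two_mul_card (by omega) (hdes.1.image s) hI
  have hcard : D.card = m := by omega
  rw [← hcard]
  exact hQ.card_le hd (by omega) hI

theorem mainTheorem2 :
    (∀ d : ℕ, Even d → 8 ≤ d →
      ∃ N : ℕ, ∀ n : ℕ, N ≤ n → ¬ ∃ X : Finset (UnitSphere d), IsStiff (2 * n) X) ∧
    (∀ d : ℕ, Even d → 12 ≤ d →
      ∃ N : ℕ, ∀ n : ℕ, N ≤ n → ¬ ∃ X : Finset (UnitSphere d), IsStiff (2 * n + 1) X) ∧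
    (∀ d : ℕ, Odd d → 3 ≤ d →
      ∃ M : ℕ, ∀ m : ℕ, M ≤ m → ¬ ∃ X : Finset (UnitSphere d), IsStiff m X) := by
  refine ⟨fun d _ hd => ⟨6 * ((2 * d) ^ 3 + 1) ^ 2 + 1, ?_⟩,
    fun d _ hd => ⟨6 * ((2 * d) ^ 3 + 1) ^ 2 + 1, ?_⟩,
    fun d _ hd => ⟨6 * ((2 * d) ^ 3 + 1) ^ 2 + 1, ?_⟩⟩
  all_goals
    rintro n hn ⟨X, hX⟩
    have := hX.le (by omega)
    omega
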